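/- Notation. Let $f:\mathbb R^d\to\mathbb R$ be twice differentiable, $\ell$-smooth ($\|\nabla f(x)-\nabla f(y)\|\le \ell\|x-y\|$ for all $x,y$) and $\rho$-Hessian Lipschitz ($\|\nabla^2 f(x)-\nabla^2 f(y)\|\le\rho\|x-y\|$ for all $x,y$, in the spectral norm), with $\ell,\rho>0$. Gradient descent with step size $\eta$ from $x_0$ is $x_{t+1}=x_t-\eta\nabla f(x_t)$. There is an absolute constant $c_{\max}>0$ such that the following two statements hold for all $d$ and all such $f,\ell,\rho$. (A) Let $\epsilon>0$, $0<c\le c_{\max}$, $\chi\ge 1$, and put $$\eta=\frac c\ell,\quad r=\frac{\sqrt c}{\chi^2}\cdot\frac{\epsilon}{\ell},\quad g_{\mathrm{thres}}=\frac{\sqrt c}{\chi^2}\,\epsilon,\quad f_{\mathrm{thres}}=\frac{c}{\chi^3}\sqrt{\frac{\epsilon^3}{\rho}},\quad t_{\mathrm{thres}}=\frac{\chi}{c^2}\cdot\frac{\ell}{\sqrt{\rho\epsilon}}.$$ Suppose $\|\nabla f(\tilde x)\|\le g_{\mathrm{thres}}$ and $\lambda_{\min}(\nabla^2 f(\tilde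 x))\le-\sqrt{\rho\epsilon}$. Let $x_0=\tilde x+\xi$ with $\xi$ uniform on the ball of radius $r$ around $0$, and let $x_t$ be the iterates of gradient descent with step size $\eta$ from $x_0$. Then, with probability at least $1-\frac{d\ell}{\sqrt{\rho\epsilon}}e^{-\chi}$, $$f(x_T)-f(\tilde x)\le -f_{\mathrm{thres}}\quad\text{for every integer } T\ge\lfloor t_{\mathrm{thres}}\rfloor,$$ in particular after $t_{\mathrm{thres}}$ steps, rounded up or down. (B) Let $\gamma>0$, $\kappa=\ell/\gamma$, $0<\delta\le d\kappa/e$, $0<\eta\le c_{\max}/\ell$, $L=\log(d\kappa/\delta)$, and put $$\mathscr F=\eta\ell\,\frac{\gamma^3}{\rho^2}L^{-3},\quad \mathscr G=\sqrt{\eta\ell}\,\frac{\gamma^2}{\rho}L^{-2},\quad \mathscr S=\sqrt{\eta\ell}\,\frac{\gamma}{\rho}L^{-1},\quad \mathscr T=\frac{L}{\eta\gamma},\quad r=\frac{\mathscr S}{\kappa L}.$$ Suppose $\|\nabla f(\tilde x)\|\le\mathscr G$ and $\lambda_{\min}(\nabla^2 f(\tilde x))\le-\gamma$. Let $x_0=\tilde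 x+\xi$ with $\xi$ uniform on the ball of radius $r$ around $0$, and let $x_t$ be the iterates of gradient descent with step size $\eta$ from $x_0$. Then, with probability at least $1-\delta$, $$f(x_T)-f(\tilde x)\le-\mathscr F\quad\text{for every integer } T\ge\tfrac1{c_{\max}}\mathscr T .$$ Moreover, for each such $T$, let the stuck region be the set of those $x_0$ in the closed ball of radius $r$ around $\tilde x$ for which $f(x_T)-f(x_0)>-2.5\,\mathscr F$. Then any two points of the stuck region that differ by a multiple of a unit eigenvector $e_1$ of $\nabla^2 f(\tilde x)$ for the eigenvalue $\lambda_{\min}(\nabla^2 f(\tilde x))$ are at distance less than $\frac{\delta r}{2\sqrt d}$; so on every line parallel to $e_1$ the stuck region has width at most $\delta r/\sqrt d$. -/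

import Mathlib

noncomputable section

namespace SaddleEscape

variable {E : Type*} [NormedAddCommGroup E] [InnerProductSpace ℝ E] [CompleteSpace E]

/-- The Hessian `∇² f (x)`, as a linear operator: the derivative of the gradient map. -/
def hessian (f : E → ℝ) (x : E) : E →L[ℝ] E :=
  fderiv ℝ (gradient f) x

/-- `f` is `l`-smooth (`l`-gradient Lipschitz). -/
def IsSmooth (l : ℝ) (f : E → ℝ) : Prop :=
  Differentiable ℝ f ∧ ∀ x y, ‖gradient f x - gradient f y‖ ≤ l * ‖x - y‖

/-- `f` is twice differentiable and `ρ`-Hessian Lipschitz (the norm is the operator norm,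
that is, the spectral norm). -/
def IsHessianLipschitz (ρ : ℝ) (f : E → ℝ) : Prop :=
  Differentiable ℝ f ∧ Differentiable ℝ (gradient f) ∧
    ∀ x y, ‖hessian f x - hessian f y‖ ≤ ρ * ‖x - y‖

/-- The smallest real eigenvalue of an operator. It is used for Hessians of twice continuously
differentiable functions, which are symmetric; on a nonzero finite-dimensional space the set
below is then finite and nonempty, and the infimum is a minimum. -/
def lambdaMin (A : E →L[ℝ] E) : ℝ :=
  sInf {μ : ℝ | Module.End.HasEigenvalue (A : E →ₗ[ℝ] E) μ}

/-- The `t`-th iterate of gradient descent with step size `η` started at `x₀`. -/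
def gdIter (f : E → ℝ) (η : ℝ) (x₀ : E) (t : ℕ) : E :=
  (fun x => x - η • gradient f x)^[t] x₀

/-- The uniform distribution on the ball of radius `r` around the origin of `ℝᵈ`. -/
def uniformBall (d : ℕ) (r : ℝ) : MeasureTheory.Measure (EuclideanSpace ℝ (Fin d)) :=
  ProbabilityTheory.cond MeasureTheory.volume (Metric.closedBall 0 r)

/-! Parameters of perturbed gradient descent. -/

/-- The step size `η = c / ℓ`. -/
def stepSize (l c : ℝ) : ℝ := c / l

/-- The perturbation radius `r = (√c / χ²) · (ε / ℓ)`. -/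
def radius (l ε c χ : ℝ) : ℝ := √c / χ ^ 2 * (ε / l)

/-- The gradient threshold `(√c / χ²) · ε`. -/
def gThres (ε c χ : ℝ) : ℝ := √c / χ ^ 2 * ε

/-- The function value threshold `(c / χ³) · √(ε³ / ρ)`. -/
def fThres (ρ ε c χ : ℝ) : ℝ := c / χ ^ 3 * √(ε ^ 3 / ρ)

/-- The (real) time threshold `(χ / c²) · ℓ / √(ρ ε)`. -/
def tThres (l ρ ε c χ : ℝ) : ℝ := χ / c ^ 2 * (l / √(ρ * ε))

/-! The units for function value, gradient, space and time, with `κ = ℓ / γ`. -/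

/-- `log (d κ / δ)`. -/
def logFactor (d : ℕ) (l γ δ : ℝ) : ℝ := Real.log (d * (l / γ) / δ)

/-- `ℱ = η ℓ (γ³ / ρ²) log⁻³ (d κ / δ)`. -/
def unitF (d : ℕ) (l ρ γ δ η : ℝ) : ℝ := η * l * (γ ^ 3 / ρ ^ 2) / logFactor d l γ δ ^ 3

/-- `𝒢 = √(η ℓ) (γ² / ρ) log⁻² (d κ / δ)`. -/
def unitG (d : ℕ) (l ρ γ δ η : ℝ) : ℝ := √(η * l) * (γ ^ 2 / ρ) / logFactor d l γ δ ^ 2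

/-- `𝒮 = √(η ℓ) (γ / ρ) log⁻¹ (d κ / δ)`. -/
def unitS (d : ℕ) (l ρ γ δ η : ℝ) : ℝ := √(η * l) * (γ / ρ) / logFactor d l γ δ

/-- `𝒯 = log (d κ / δ) / (η γ)`. -/
def unitT (d : ℕ) (l γ δ η : ℝ) : ℝ := logFactor d l γ δ / (η * γ)

/-- The perturbation radius `𝒮 / (κ log (d κ / δ))`. -/
def unitRadius (d : ℕ) (l ρ γ δ η : ℝ) : ℝ :=
  unitS d l ρ γ δ η / (l / γ * logFactor d l γ δ)

/-- The stuck region of the perturbation ball of radius `r` around `x'`: the starting points from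
which `T` steps of gradient descent decrease the function value by less than `drop`. -/
def stuckRegion (f : E → ℝ) (η : ℝ) (x' : E) (r drop : ℝ) (T : ℕ) : Set E :=
  {x | x ∈ Metric.closedBall x' r ∧ -drop < f (gdIter f η x T) - f x}

end SaddleEscape

end

/-! Run gradient descent from two points of the perturbation ball that differ by `s • e`, with `e` a
unit eigenvector for the smallest eigenvalue of the Hessian `H` at the saddle. Each step lowers `f`
by at least `η / 2` times the squared gradient norm, so by Cauchy–Schwarz a trajectory with little
total decrease stays near its start. If both trajectories are stuck, they remain in a ball of radius
`R` where the Hessian is within `ρ * R` of `H`.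

Their difference then follows the linear recursion `I - η H` up to a relative error `η * ρ * R` per
step. It starts in the direction in which `I - η H` attains its norm, so over a horizon on which the
errors sum to a small constant it keeps half of the growth `(1 - η λ_min) ^ N`. It also stays below
`2 * R`, which forces `|s|` to be exponentially small (`abs_mul_pow_le_of_stuck`,
`stuckRegion_width`).

By Fubini, a set thin along `e` has volume at most its width times that of a ball of one dimension
less; log-convexity of Gamma turns this into probability at most `δ` (`le_uniformBall_of_width`).
Outside the stuck set `f` drops by three units, while the perturbation raises it by at most two.
Statement (A) is the case `γ = √(ρ ε)` with `δ` chosen so that the logarithmic factor is `χ`. -/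

section

namespace SaddleEscape

variable {E : Type*} [NormedAddCommGroup E] [InnerProductSpace ℝ E]

open Metric

/-! ### Perturbed linear recursions -/

/-- A linear recursion that grows by the factor `a` in the direction of the initial vector keeps
half of that growth under a small relative perturbation. -/
theorem half_growth_of_perturbed {E : Type*} [NormedAddCommGroup E] [NormedSpace ℝ E]
    {A : E →L[ℝ] E} {a β : ℝ} (ha : 1 ≤ a) (hβ : 0 ≤ β)
    (hA : ∀ x, ‖A x‖ ≤ a * ‖x‖) {v : ℕ → E} (hA0 : A (v 0) = a • v 0) {T : ℕ}
    (hv : ∀ t < T, ‖v (t + 1) - A (v t)‖ ≤ β * ‖v t‖) (hT : 2 * T * β ≤ 1 / 2) :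
    a ^ T * ‖v 0‖ ≤ 2 * ‖v T‖ := by
  have ha0 : 0 ≤ a := zero_le_one.trans ha
  have hpow : ∀ t, A (a ^ t • v 0) = a ^ (t + 1) • v 0 := fun t => by
    rw [map_smul, hA0, smul_smul, pow_succ]
  -- The hypothesis on `T` keeps the relative deviation at most `1 / 2`, hence `‖v t‖` below `2 * a
  -- ^ t * ‖v 0‖`; each step therefore adds at most `2 * β` to it.
  have hq : ∀ t ≤ T, ‖v t - a ^ t • v 0‖ ≤ a ^ t * (2 * t * β) * ‖v 0‖ := by
    intro t
    induction t with
    | zero => simp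
    | succ t ih =>
      intro ht
      have ih := ih (by omega)
      have htT : (2 * t * β : ℝ) ≤ 1 / 2 := by
        have : (t : ℝ) ≤ T := by exact_mod_cast (by omega : t ≤ T)
        nlinarith
      have hn : ‖a ^ t • v 0‖ = a ^ t * ‖v 0‖ := by
        rw [norm_smul, Real.norm_eq_abs, abs_of_nonneg (by positivity)]
      have hP : 0 ≤ a ^ t * ‖v 0‖ := by positivity
      have hvt : ‖v t‖ ≤ 2 * (a ^ t * ‖v 0‖) := by
        have := norm_le_insert' (v t) (a ^ t • v 0)
        nlinarith
      have hstep : v (t + 1) - a ^ (t + 1) • v 0 =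
          A (v t - a ^ t • v 0) + (v (t + 1) - A (v t)) := by
        rw [map_sub, hpow]; abel
      rw [hstep]
      calc _ ≤ a * ‖v t - a ^ t • v 0‖ + β * ‖v t‖ :=
            (norm_add_le _ _).trans (add_le_add (hA _) (hv t (by omega)))
        _ ≤ a * (a ^ t * (2 * t * β) * ‖v 0‖) + β * (2 * (a ^ t * ‖v 0‖)) := by gcongr
        _ ≤ a * (a ^ t * (2 * t * β) * ‖v 0‖) + a * (β * (2 * (a ^ t * ‖v 0‖))) := by
            exact add_le_add_right (le_mul_of_one_le_left (by positivity) ha) _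
        _ = _ := by push_cast; ring
  have h := hq T le_rfl
  have hn : ‖a ^ T • v 0‖ = a ^ T * ‖v 0‖ := by
    rw [norm_smul, Real.norm_eq_abs, abs_of_nonneg (by positivity)]
  have h2 := norm_le_insert (v T) (a ^ T • v 0)
  have hP : 0 ≤ a ^ T * ‖v 0‖ := by positivity
  nlinarith

/-! ### Descent, localization and linearization of the gradient -/

section Smooth

variable [CompleteSpace E] {f : E → ℝ} {l ρ η : ℝ}

theorem gdIter_zero (f : E → ℝ) (η : ℝ) (x : E) : gdIter f η x 0 = x := rfl

theorem gdIter_succ (f : E → ℝ) (η : ℝ) (x : E) (t : ℕ) :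
    gdIter f η x (t + 1) = gdIter f η x t - η • gradient f (gdIter f η x t) :=
  Function.iterate_succ_apply' _ _ _

/-- First-order Taylor estimate for a smooth function. -/
theorem IsSmooth.le_linear_add (hf : IsSmooth l f) (hl : 0 ≤ l) (x y : E) :
    f y ≤ f x + inner ℝ (gradient f x) (y - x) + l * ‖y - x‖ ^ 2 := by
  have key := (convex_closedBall x ‖y - x‖).norm_image_sub_le_of_norm_hasFDerivWithin_le'
    (f := f) (f' := fun z => InnerProductSpace.toDual ℝ E (gradient f z))
    (φ := InnerProductSpace.toDual ℝ E (gradient f x)) (C := l * ‖y - x‖)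
    (fun z _ => (hf.1 z).hasGradientAt.hasFDerivAt.hasFDerivWithinAt)
    (fun z hz => by
      rw [← map_sub, LinearIsometryEquiv.norm_map]
      exact (hf.2 z x).trans (mul_le_mul_of_nonneg_left (mem_closedBall_iff_norm.1 hz) hl))
    (mem_closedBall_self (norm_nonneg _)) (mem_closedBall_iff_norm.2 le_rfl)
  rw [InnerProductSpace.toDual_apply_apply, Real.norm_eq_abs] at key
  nlinarith [le_abs_self (f y - f x - inner ℝ (gradient f x) (y - x))]

theorem IsSmooth.gd_step (hf : IsSmooth l f) (hl : 0 ≤ l) (hη : 0 ≤ η) (hηl : η * l ≤ 1 / 2)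
    (x : E) : f (x - η • gradient f x) ≤ f x - η / 2 * ‖gradient f x‖ ^ 2 := by
  have h := hf.le_linear_add hl x (x - η • gradient f x)
  have e : x - η • gradient f x - x = -(η • gradient f x) := by abel
  rw [e, inner_neg_right, inner_smul_right, real_inner_self_eq_norm_sq, norm_neg, norm_smul,
    Real.norm_eq_abs, abs_of_nonneg hη] at h
  have : η * ‖gradient f x‖ ^ 2 * (η * l) ≤ η * ‖gradient f x‖ ^ 2 * (1 / 2) :=
    mul_le_mul_of_nonneg_left hηl (by positivity)
  nlinarith

theorem IsSmooth.gdIter_antitone (hf : IsSmooth l f) (hl : 0 ≤ l) (hη : 0 ≤ η)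
    (hηl : η * l ≤ 1 / 2) (x : E) : Antitone fun t => f (gdIter f η x t) := by
  refine antitone_nat_of_succ_le fun t => ?_
  rw [gdIter_succ]
  exact (hf.gd_step hl hη hηl _).trans (sub_le_self _ (by positivity))

/-- Gradient descent either decreases the function or stays close to where it started. -/
theorem IsSmooth.gdIter_localized (hf : IsSmooth l f) (hl : 0 ≤ l) (hη : 0 ≤ η)
    (hηl : η * l ≤ 1 / 2) (x : E) (t : ℕ) :
    ‖gdIter f η x t - x‖ ^ 2 ≤ t * (2 * η * (f x - f (gdIter f η x t))) := by
  set g : ℕ → E := fun i => gradient f (gdIter f η x i) with hg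
  have h1 : ‖gdIter f η x t - x‖ ≤ ∑ i ∈ Finset.range t, η * ‖g i‖ := by
    induction t with
    | zero => simp [gdIter_zero]
    | succ t ih =>
      rw [Finset.sum_range_succ, gdIter_succ]
      calc _ = ‖(gdIter f η x t - x) - η • g t‖ := by congr 1; rw [hg]; abel
        _ ≤ ‖gdIter f η x t - x‖ + ‖η • g t‖ := norm_sub_le _ _
        _ ≤ _ := by rw [norm_smul, Real.norm_eq_abs, abs_of_nonneg hη]; gcongr
  have h2 : ∑ i ∈ Finset.range t, (η * ‖g i‖) ^ 2 ≤ 2 * η * (f x - f (gdIter f η x t)) := by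
    clear h1
    induction t with
    | zero => simp [gdIter_zero]
    | succ t ih =>
      rw [Finset.sum_range_succ, gdIter_succ]
      nlinarith [hf.gd_step hl hη hηl (gdIter f η x t)]
  calc _ ≤ (∑ i ∈ Finset.range t, η * ‖g i‖) ^ 2 := by gcongr
    _ ≤ t * ∑ i ∈ Finset.range t, (η * ‖g i‖) ^ 2 := by
      simpa using sq_sum_le_card_mul_sum_sq (s := Finset.range t) (f := fun i => η * ‖g i‖)
    _ ≤ _ := by gcongr

/-- Because `f` decreases along the iterates, a small drop at time `T` bounds the drop at all
earlier times, so localization applies to the whole trajectory; `hR` leaves room for the initial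
offset `r`. -/
theorem IsSmooth.norm_gdIter_sub_le (hf : IsSmooth l f) (hl : 0 ≤ l) (hη : 0 ≤ η)
    (hηl : η * l ≤ 1 / 2) {x x' : E} {r D R : ℝ} {T t : ℕ} (hx : ‖x - x'‖ ≤ r) (hrR : r ≤ R)
    (hR : T * (2 * η * D) ≤ (R - r) ^ 2) (hD : -D < f (gdIter f η x T) - f x) (ht : t ≤ T) :
    ‖gdIter f η x t - x'‖ ≤ R := by
  have hanti := hf.gdIter_antitone hl hη hηl x
  have h0 : f (gdIter f η x T) ≤ f (gdIter f η x t) := hanti ht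
  have h1 : f (gdIter f η x T) ≤ f x := hanti (Nat.zero_le T)
  have h2 : ‖gdIter f η x t - x‖ ^ 2 ≤ (R - r) ^ 2 := by
    refine (hf.gdIter_localized hl hη hηl x t).trans (le_trans ?_ hR)
    have hD0 : 0 ≤ D := by linarith
    calc (t : ℝ) * (2 * η * (f x - f (gdIter f η x t))) ≤ t * (2 * η * D) := by gcongr; linarith
      _ ≤ T * (2 * η * D) := by gcongr
  have h3 : ‖gdIter f η x t - x‖ ≤ R - r := (abs_le_of_sq_le_sq' h2 (by linarith)).2
  calc _ = ‖(gdIter f η x t - x) + (x - x')‖ := by congr 1; abel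
    _ ≤ _ := (norm_add_le _ _).trans (by linarith)

theorem IsSmooth.continuous_gdIter (hf : IsSmooth l f) (η : ℝ) (t : ℕ) :
    Continuous fun x => gdIter f η x t := by
  have hlip : LipschitzWith (Real.toNNReal l) (gradient f) :=
    LipschitzWith.of_dist_le' fun x y => by simpa [dist_eq_norm] using hf.2 x y
  exact (continuous_id.sub (hlip.continuous.const_smul η)).iterate t

theorem IsSmooth.norm_hessian_le (hf : IsSmooth l f) (hl : 0 ≤ l) (x : E) :
    ‖hessian f x‖ ≤ l := by
  have hlip : LipschitzWith (Real.toNNReal l) (gradient f) :=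
    LipschitzWith.of_dist_le' fun x y => by simpa [dist_eq_norm] using hf.2 x y
  simpa [hessian, hl] using norm_fderiv_le_of_lipschitz ℝ (x₀ := x) hlip

theorem IsHessianLipschitz.isSymmetric_hessian (hf : IsHessianLipschitz ρ f) (x : E) :
    (hessian f x : E →ₗ[ℝ] E).IsSymmetric := by
  intro v w
  let J : E →L[ℝ] (E →L[ℝ] ℝ) := innerSL ℝ
  have h1 : ∀ y, HasFDerivAt f (J (gradient f y)) y := fun y => (hf.1 y).hasGradientAt.hasFDerivAt
  have h2 : HasFDerivAt (fun y => J (gradient f y)) (J.comp (hessian f x)) x :=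
    J.hasFDerivAt.comp x (hf.2.1 x).hasFDerivAt
  have h3 := second_derivative_symmetric h1 h2 v w
  have h4 : inner ℝ (hessian f x v) w = inner ℝ (hessian f x w) v := h3
  change inner ℝ (hessian f x v) w = inner ℝ v (hessian f x w)
  rw [h4, real_inner_comm]

/-- Near `x'` the gradient is close to its linearization at `x'`. -/
theorem IsHessianLipschitz.norm_gradient_sub_le (hf : IsHessianLipschitz ρ f) (hρ : 0 ≤ ρ)
    {x' u w : E} {R : ℝ} (hu : ‖u - x'‖ ≤ R) (hw : ‖w - x'‖ ≤ R) :
    ‖gradient f u - gradient f w - hessian f x' (u - w)‖ ≤ ρ * R * ‖u - w‖ :=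
  (convex_closedBall x' R).norm_image_sub_le_of_norm_fderiv_le' (fun z _ => hf.2.1 z)
    (fun z hz => (hf.2.2 z x').trans
      (mul_le_mul_of_nonneg_left (mem_closedBall_iff_norm.1 hz) hρ))
    (mem_closedBall_iff_norm.2 hw) (mem_closedBall_iff_norm.2 hu)

end Smooth

/-! ### The smallest eigenvalue and pairs of trajectories -/

section Eigen

variable [FiniteDimensional ℝ E]

theorem lambdaMin_le {A : E →L[ℝ] E} {μ : ℝ}
    (h : Module.End.HasEigenvalue (A : E →ₗ[ℝ] E) μ) : lambdaMin A ≤ μ :=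
  csInf_le (Module.End.finite_hasEigenvalue _).bddBelow h

/-- The infimum of the empty set is `0`, so a nonzero value certifies that an eigenvalue exists;
finiteness of the spectrum makes the infimum attained. -/
theorem exists_eigenvector_lambdaMin {A : E →L[ℝ] E} (h : lambdaMin A ≠ 0) :
    ∃ e : E, ‖e‖ = 1 ∧ A e = lambdaMin A • e := by
  have hne : {μ : ℝ | Module.End.HasEigenvalue (A : E →ₗ[ℝ] E) μ}.Nonempty := by
    by_contra hcon
    exact h (by rw [lambdaMin, Set.not_nonempty_iff_eq_empty.1 hcon, Real.sInf_empty])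
  have hmem : Module.End.HasEigenvalue (A : E →ₗ[ℝ] E) (lambdaMin A) :=
    hne.csInf_mem (Module.End.finite_hasEigenvalue _)
  obtain ⟨v, hv⟩ := hmem.exists_hasEigenvector
  have hv0 : ‖v‖ ≠ 0 := norm_ne_zero_iff.2 hv.2
  refine ⟨‖v‖⁻¹ • v, by rw [norm_smul, norm_inv, norm_norm, inv_mul_cancel₀ hv0], ?_⟩
  have : A v = lambdaMin A • v := hv.apply_eq_smul
  rw [map_smul, this, smul_comm]

/-- The operator norm of a gradient step is attained at the smallest eigenvalue. -/
theorem norm_sub_smul_le {A : E →L[ℝ] E} (hA : (A : E →ₗ[ℝ] E).IsSymmetric) {l η : ℝ}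
    (hl : ‖A‖ ≤ l) (hη : 0 ≤ η) (hηl : η * l ≤ 1) (x : E) :
    ‖x - η • A x‖ ≤ (1 - η * lambdaMin A) * ‖x‖ := by
  let b := hA.eigenvectorBasis (n := Module.finrank ℝ E) rfl
  let ev := hA.eigenvalues (n := Module.finrank ℝ E) rfl
  have hev : ∀ i, A (b i) = ev i • b i := fun i => hA.apply_eigenvectorBasis rfl i
  have hmin : ∀ i, lambdaMin A ≤ ev i := fun i =>
    lambdaMin_le (hA.hasEigenvalue_eigenvalues rfl i)
  have hmax : ∀ i, ev i ≤ l := fun i => by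
    have h := A.le_opNorm (b i)
    rw [hev, norm_smul, b.norm_eq_one, mul_one, mul_one] at h
    exact (le_abs_self _).trans (h.trans hl)
  have hcoord : ∀ i, inner ℝ (b i) (x - η • A x) = (1 - η * ev i) * inner ℝ (b i) x := by
    intro i
    have : inner ℝ (b i) (A x) = ev i * inner ℝ (b i) x := by
      have h : inner ℝ (A (b i)) x = inner ℝ (b i) (A x) := hA (b i) x
      rw [← h, hev, real_inner_smul_left]
    rw [inner_sub_right, inner_smul_right, this]; ring
  -- Since `η * l ≤ 1`, no eigenvalue of `I - η A` is negative, so the one of largest modulus comes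
  -- from `lambdaMin A`.
  have hnn : ∀ i, 0 ≤ 1 - η * ev i := fun i => by nlinarith [hmax i]
  have hle : ∀ i, 1 - η * ev i ≤ 1 - η * lambdaMin A := fun i => by nlinarith [hmin i]
  by_cases hE : Nonempty (Fin (Module.finrank ℝ E))
  · obtain ⟨i0⟩ := hE
    have ha : 0 ≤ 1 - η * lambdaMin A := (hnn i0).trans (hle i0)
    refine (abs_le_of_sq_le_sq' ?_ (by positivity)).2
    rw [mul_pow, ← b.sum_sq_norm_inner_right, ← b.sum_sq_norm_inner_right x, Finset.mul_sum]
    refine Finset.sum_le_sum fun i _ => ?_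
    rw [hcoord, norm_mul, mul_pow, Real.norm_eq_abs, sq_abs]
    gcongr
    · exact hnn i
    · exact hmin i
  · have : Module.finrank ℝ E = 0 := by
      by_contra h
      exact hE ⟨⟨0, Nat.pos_of_ne_zero h⟩⟩
    have := Module.finrank_zero_iff.1 this
    rw [Subsingleton.elim x 0]; simp

variable [CompleteSpace E] {f : E → ℝ} {l ρ η : ℝ}

/-- Two stuck points on a line along the minimum eigendirection are exponentially close. -/
theorem abs_mul_pow_le_of_stuck (hf : IsSmooth l f) (hf' : IsHessianLipschitz ρ f) (hl : 0 ≤ l)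
    (hρ : 0 ≤ ρ) (hη : 0 ≤ η) (hηl : η * l ≤ 1 / 2) {x' u e : E} {r D R s : ℝ} {T : ℕ}
    (hr : r ≤ R) (hR0 : 0 ≤ R) (hR : T * (2 * η * D) ≤ (R - r) ^ 2)
    (hT : 2 * T * (η * (ρ * R)) ≤ 1 / 2)
    (hmin : lambdaMin (hessian f x') ≤ 0) (he1 : ‖e‖ = 1)
    (he : hessian f x' e = lambdaMin (hessian f x') • e)
    (hu : u ∈ stuckRegion f η x' r D T) (hw : u + s • e ∈ stuckRegion f η x' r D T) :
    (1 - η * lambdaMin (hessian f x')) ^ T * |s| ≤ 4 * R := by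
  set H := hessian f x' with hH
  have hul := fun t (ht : t ≤ T) => hf.norm_gdIter_sub_le hl hη hηl
    (mem_closedBall_iff_norm.1 hu.1) hr hR hu.2 ht
  have hwl := fun t (ht : t ≤ T) => hf.norm_gdIter_sub_le hl hη hηl
    (mem_closedBall_iff_norm.1 hw.1) hr hR hw.2 ht
  let v : ℕ → E := fun t => gdIter f η (u + s • e) t - gdIter f η u t
  let A : E →L[ℝ] E := ContinuousLinearMap.id ℝ E - η • H
  have hAx : ∀ x, A x = x - η • H x := fun x => rfl
  have hv0 : v 0 = s • e := by simp [v, gdIter_zero]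
  -- The initial difference `s • e` is an eigenvector of `I - η H` for its norm bound `1 - η λ_min`;
  -- the per-step error is `η` times the linearization error of the gradient.
  have hgrow := half_growth_of_perturbed (A := A) (a := 1 - η * lambdaMin H) (β := η * (ρ * R))
    (by nlinarith) (by positivity)
    (fun x => norm_sub_smul_le (hf'.isSymmetric_hessian x') (hf.norm_hessian_le hl x') hη
      (by linarith) x) (v := v)
    (by rw [hAx, hv0, map_smul, he]; module) (T := T)
    (fun t ht => by
      have h := hf'.norm_gradient_sub_le hρ (hwl t ht.le) (hul t ht.le)
      have e1 : v (t + 1) - A (v t) = -(η • (gradient f (gdIter f η (u + s • e) t) -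
          gradient f (gdIter f η u t) - H (v t))) := by
        simp only [v, hAx, gdIter_succ]; module
      rw [e1, norm_neg, norm_smul, Real.norm_eq_abs, abs_of_nonneg hη, mul_assoc]
      exact mul_le_mul_of_nonneg_left h hη) hT
  have hvT : ‖v T‖ ≤ 2 * R := by
    have := norm_sub_le_norm_sub_add_norm_sub (gdIter f η (u + s • e) T) x' (gdIter f η u T)
    have h1 := hul T le_rfl
    have h2 := hwl T le_rfl
    rw [norm_sub_rev] at h1
    exact this.trans (by linarith)
  rw [hv0, norm_smul, he1, mul_one, Real.norm_eq_abs] at hgrow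
  linarith

end Eigen

end SaddleEscape

end

/-! ### Volume of thin subsets of a ball -/

section

namespace SaddleEscape

open MeasureTheory Metric

theorem volume_le_of_abs_sub_le {A : Set ℝ} {w : ℝ} (h : ∀ a ∈ A, ∀ b ∈ A, |a - b| ≤ w) :
    volume A ≤ ENNReal.ofReal w :=
  (Real.volume_le_diam A).trans <| ediam_le fun a ha b hb => by
    rw [edist_dist, Real.dist_eq]
    exact ENNReal.ofReal_le_ofReal (h a ha b hb)

/-- A subset of a ball all of whose sections in the direction `e` have diameter at most `w` has
volume at most `w` times that of the ball of one dimension less. -/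
theorem volume_le_of_width {n : ℕ} {S : Set (EuclideanSpace ℝ (Fin (n + 1)))} {r w : ℝ}
    {e : EuclideanSpace ℝ (Fin (n + 1))} (hS : MeasurableSet S) (hSr : S ⊆ closedBall 0 r)
    (he : ‖e‖ = 1) (hw : ∀ u ∈ S, ∀ s : ℝ, u + s • e ∈ S → |s| ≤ w) :
    volume S ≤ ENNReal.ofReal w * volume (closedBall (0 : EuclideanSpace ℝ (Fin n)) r) := by
  obtain ⟨b, hb⟩ := Orthonormal.exists_orthonormalBasis_extension_of_card_eq (𝕜 := ℝ)
    (E := EuclideanSpace ℝ (Fin (n + 1))) (ι := Fin (n + 1)) (by simp) (v := fun _ => e)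
    (s := {0}) (by
      rw [orthonormal_iff_ite]
      rintro ⟨i, hi⟩ ⟨j, hj⟩
      simp only [Set.mem_singleton_iff] at hi hj
      subst hi; subst hj
      simp [Set.domRestrict, he])
  have hb0 : b 0 = e := hb 0 rfl
  -- Measure-preserving coordinates: the first is the component along `e`, the others form the
  -- orthogonal complement.
  let Ψ : ℝ × (Fin n → ℝ) → EuclideanSpace ℝ (Fin (n + 1)) := fun p =>
    b.repr.symm (WithLp.toLp 2 ((MeasurableEquiv.piFinSuccAbove (fun _ => ℝ) 0).symm p))
  have hΨ : MeasurePreserving Ψ (volume : Measure (ℝ × (Fin n → ℝ))) volume :=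
    b.measurePreserving_repr_symm.comp ((PiLp.volume_preserving_toLp _).comp
      (volume_preserving_piFinSuccAbove (fun _ : Fin (n + 1) => ℝ) 0).symm)
  have hΨadd : ∀ a s y, Ψ (a, y) + s • e = Ψ (a + s, y) := by
    intro a s y
    apply b.repr.injective
    rw [map_add, map_smul, ← hb0, b.repr_self]
    ext i
    refine Fin.cases ?_ (fun j => ?_) i <;>
      simp [Ψ, MeasurableEquiv.piFinSuccAbove, Fin.insertNthEquiv]
  have hΨnorm : ∀ a y, ‖WithLp.toLp 2 y‖ ≤ ‖Ψ (a, y)‖ := by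
    intro a y
    simp only [Ψ, LinearIsometryEquiv.norm_map, EuclideanSpace.norm_eq]
    refine Real.sqrt_le_sqrt ?_
    rw [Fin.sum_univ_succ]
    simp [MeasurableEquiv.piFinSuccAbove, Fin.insertNthEquiv]
    positivity
  have hB : volume ((WithLp.toLp 2) ⁻¹' closedBall (0 : EuclideanSpace ℝ (Fin n)) r) =
      volume (closedBall (0 : EuclideanSpace ℝ (Fin n)) r) :=
    (PiLp.volume_preserving_toLp (Fin n)).measure_preimage
      measurableSet_closedBall.nullMeasurableSet
  have hBm : MeasurableSet ((WithLp.toLp 2) ⁻¹' closedBall (0 : EuclideanSpace ℝ (Fin n)) r) :=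
    (PiLp.volume_preserving_toLp (Fin n)).measurable measurableSet_closedBall
  -- Fubini with the `e` coordinate inside: each fibre has diameter at most `w`, and it is empty
  -- unless `y` lies in the lower-dimensional ball.
  rw [← hΨ.measure_preimage hS.nullMeasurableSet, Measure.volume_eq_prod,
    Measure.prod_apply_symm (hΨ.measurable hS), ← hB, ← setLIntegral_const,
    ← lintegral_indicator hBm]
  refine lintegral_mono fun y => ?_
  by_cases hy : y ∈ (WithLp.toLp 2) ⁻¹' closedBall (0 : EuclideanSpace ℝ (Fin n)) r
  · rw [Set.indicator_of_mem hy]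
    refine volume_le_of_abs_sub_le fun a ha c hc => ?_
    refine hw (Ψ (c, y)) hc (a - c) ?_
    rw [hΨadd, add_sub_cancel]
    exact ha
  · rw [Set.indicator_of_notMem hy]
    refine (measure_mono_null (fun a ha => hy ?_) measure_empty).le
    have := hSr (show Ψ (a, y) ∈ S from ha)
    rw [mem_closedBall_zero_iff] at this
    exact mem_closedBall_zero_iff.2 ((hΨnorm a y).trans this)

/-- Log-convexity of Gamma at the midpoint of `x` and `x + 1`, together with `Γ(x + 1) = x Γ(x)`. -/
theorem Gamma_add_half_le {x : ℝ} (hx : 0 < x) :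
    Real.Gamma (x + 1 / 2) ≤ √x * Real.Gamma x := by
  have h := Real.Gamma_mul_add_mul_le_rpow_Gamma_mul_rpow_Gamma hx (by linarith : 0 < x + 1)
    (by norm_num : (0 : ℝ) < 1 / 2) (by norm_num : (0 : ℝ) < 1 / 2) (by norm_num)
  have hG := Real.Gamma_pos_of_pos hx
  rw [Real.Gamma_add_one hx.ne', ← Real.sqrt_eq_rpow, ← Real.sqrt_eq_rpow,
    Real.sqrt_mul hx.le] at h
  calc _ = Real.Gamma (1 / 2 * x + 1 / 2 * (x + 1)) := by congr 1; ring
    _ ≤ _ := h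
    _ = √x * (√(Real.Gamma x) * √(Real.Gamma x)) := by ring
    _ = _ := by rw [Real.mul_self_sqrt hG.le]

/-- Dimension `0` is needed as the cross-section of a one-dimensional ball; there the ball is a
point of mass one. -/
theorem volume_closedBall_fin (n : ℕ) {r : ℝ} (hr : 0 ≤ r) :
    volume (closedBall (0 : EuclideanSpace ℝ (Fin n)) r) =
      ENNReal.ofReal (r ^ n * (√Real.pi ^ n / Real.Gamma (n / 2 + 1))) := by
  rcases n with _ | n
  · rw [volume_euclideanSpace_eq_dirac, Measure.dirac_apply_of_mem (by simpa using hr)]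
    simp
  · rw [EuclideanSpace.volume_closedBall, ← ENNReal.ofReal_pow hr, ← ENNReal.ofReal_mul (by positivity)]
    simp

/-- Comparison of the volumes of balls in consecutive dimensions. -/
theorem mul_volume_closedBall_le (n : ℕ) {r δ : ℝ} (hr : 0 ≤ r) (hδ : 0 ≤ δ) :
    ENNReal.ofReal (δ * r / (2 * √(n + 1 : ℕ))) *
        volume (closedBall (0 : EuclideanSpace ℝ (Fin n)) r) ≤
      ENNReal.ofReal δ * volume (closedBall (0 : EuclideanSpace ℝ (Fin (n + 1))) r) := by
  rw [volume_closedBall_fin n hr, volume_closedBall_fin (n + 1) hr,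
    ← ENNReal.ofReal_mul (by positivity), ← ENNReal.ofReal_mul hδ]
  refine ENNReal.ofReal_le_ofReal ?_
  have hx : (0 : ℝ) < n / 2 + 1 := by positivity
  have hG := Real.Gamma_pos_of_pos hx
  have hG' := Real.Gamma_pos_of_pos (show (0 : ℝ) < n / 2 + 1 + 1 / 2 by positivity)
  have h1 := Gamma_add_half_le hx
  have h2 : √((n : ℝ) / 2 + 1) ≤ 2 * √(n + 1 : ℕ) * √Real.pi := by
    have h3 : √((n : ℝ) / 2 + 1) ≤ √(n + 1 : ℕ) := by
      refine Real.sqrt_le_sqrt ?_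
      push_cast
      have : (0 : ℝ) ≤ n := n.cast_nonneg
      linarith
    have h4 : 1 ≤ √Real.pi := Real.one_le_sqrt.2 (by linarith [Real.pi_gt_three])
    nlinarith [Real.sqrt_nonneg ((n + 1 : ℕ) : ℝ)]
  have e : (((n + 1 : ℕ) : ℝ) / 2 + 1) = n / 2 + 1 + 1 / 2 := by push_cast; ring
  rw [e]
  have hs : 0 < √((n + 1 : ℕ) : ℝ) := Real.sqrt_pos.2 (by positivity)
  have h5 : Real.Gamma (n / 2 + 1 + 1 / 2) ≤
      2 * √(n + 1 : ℕ) * √Real.pi * Real.Gamma (n / 2 + 1) :=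
    h1.trans (mul_le_mul_of_nonneg_right h2 hG.le)
  have h6 : 1 / (2 * √(n + 1 : ℕ) * Real.Gamma (n / 2 + 1)) ≤
      √Real.pi / Real.Gamma (n / 2 + 1 + 1 / 2) := by
    rw [div_le_div_iff₀ (by positivity) hG']
    linarith
  calc _ = δ * r ^ (n + 1) * √Real.pi ^ n *
        (1 / (2 * √(n + 1 : ℕ) * Real.Gamma (n / 2 + 1))) := by
        rw [pow_succ]; field_simp
    _ ≤ δ * r ^ (n + 1) * √Real.pi ^ n * (√Real.pi / Real.Gamma (n / 2 + 1 + 1 / 2)) := by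
        gcongr
    _ = _ := by rw [pow_succ √Real.pi]; ring

/-- A measurable exceptional set of small width in one direction has small probability under the
uniform distribution on a ball. -/
theorem le_uniformBall_of_width {n : ℕ} {S P : Set (EuclideanSpace ℝ (Fin (n + 1)))} {r δ : ℝ}
    {e : EuclideanSpace ℝ (Fin (n + 1))} (hr : 0 < r) (hδ : 0 ≤ δ) (hS : MeasurableSet S)
    (hSr : S ⊆ closedBall 0 r) (he : ‖e‖ = 1)
    (hw : ∀ u ∈ S, ∀ s : ℝ, u + s • e ∈ S → |s| ≤ δ * r / (2 * √(n + 1 : ℕ)))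
    (hP : closedBall 0 r \ S ⊆ P) : 1 - δ ≤ (uniformBall (n + 1) r).real P := by
  set B := closedBall (0 : EuclideanSpace ℝ (Fin (n + 1))) r with hB
  have hB0 : volume B ≠ 0 := (measure_closedBall_pos _ _ hr).ne'
  have hBt : volume B ≠ ⊤ := measure_closedBall_lt_top.ne
  have hprob : IsProbabilityMeasure (uniformBall (n + 1) r) :=
    ProbabilityTheory.cond_isProbabilityMeasure_of_finite hB0 hBt
  have hvol : volume S ≤ ENNReal.ofReal δ * volume B :=
    (volume_le_of_width hS hSr he hw).trans (mul_volume_closedBall_le n hr.le hδ)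
  have hSle : (uniformBall (n + 1) r).real S ≤ δ := by
    refine ENNReal.toReal_le_of_le_ofReal hδ ?_
    rw [uniformBall, ProbabilityTheory.cond_apply measurableSet_closedBall, ← hB,
      Set.inter_eq_right.2 hSr, mul_comm, ← div_eq_mul_inv]
    exact ENNReal.div_le_of_le_mul hvol
  have hBone : (uniformBall (n + 1) r).real B = 1 := by
    rw [Measure.real, uniformBall, ProbabilityTheory.cond_apply_self hB0 hBt]
    rfl
  -- Covering the ball by `P ∪ S` and using subadditivity avoids any measurability of `P`.
  have h1 : (uniformBall (n + 1) r).real B ≤ (uniformBall (n + 1) r).real (P ∪ S) :=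
    measureReal_mono fun x hx => by
      by_cases hxS : x ∈ S
      · exact Or.inr hxS
      · exact Or.inl (hP ⟨hx, hxS⟩)
  have h2 := measureReal_union_le (μ := uniformBall (n + 1) r) P S
  linarith

end SaddleEscape

end

/-! ### Numerical bounds and relations between the units -/

section

namespace SaddleEscape

open Metric

theorem one_le_logFactor {d : ℕ} {l γ δ : ℝ} (hδ : 0 < δ)
    (hδd : δ ≤ d * (l / γ) / Real.exp 1) :
    1 ≤ logFactor d l γ δ ∧ Real.exp (logFactor d l γ δ) = d * (l / γ) / δ := by
  have h : Real.exp 1 ≤ d * (l / γ) / δ := by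
    rw [le_div_iff₀ hδ, mul_comm]
    exact (le_div_iff₀ (Real.exp_pos 1)).1 hδd
  have hpos := (Real.exp_pos 1).trans_le h
  exact ⟨(Real.le_log_iff_exp_le hpos).2 h, Real.exp_log hpos⟩

/-- From `1 - x / 2 ≤ exp (-x / 2)` and `1 ≤ (1 + x) * (1 - x / 2)` on `[0, 1]`. It turns powers of
`1 + η γ` into exponentials. -/
theorem exp_half_le_one_add {x : ℝ} (h0 : 0 ≤ x) (h1 : x ≤ 1) : Real.exp (x / 2) ≤ 1 + x := by
  have h := Real.add_one_le_exp (-(x / 2))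
  rw [Real.exp_neg] at h
  have hp := Real.exp_pos (x / 2)
  have h2 : (-(x / 2) + 1) * Real.exp (x / 2) ≤ 1 := by
    calc _ ≤ (Real.exp (x / 2))⁻¹ * Real.exp (x / 2) := by gcongr
      _ = 1 := inv_mul_cancel₀ hp.ne'
  nlinarith

theorem mul_lt_exp_seven {L : ℝ} (hL : 1 ≤ L) : 120 * L < Real.exp (7 * L) := by
  have h1 : L < Real.exp L := by linarith [Real.add_one_le_exp L]
  have h2 : 120 < Real.exp (6 * L) := by
    have h3 : (2.7 : ℝ) ^ 6 ≤ Real.exp 1 ^ 6 := by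
      gcongr
      linarith [Real.exp_one_gt_d9]
    calc (120 : ℝ) < 2.7 ^ 6 := by norm_num
      _ ≤ Real.exp (6 * 1) := by
        rw [← Real.exp_nat_mul] at h3
        exact_mod_cast h3
      _ ≤ _ := Real.exp_le_exp.2 (by linarith)
  have h4 : Real.exp (7 * L) = Real.exp (6 * L) * Real.exp L := by
    rw [← Real.exp_add]; congr 1; ring
  rw [h4]
  nlinarith [Real.exp_pos L]

section Units

variable {d : ℕ} {l ρ γ δ η : ℝ}

theorem unitS_pos (hl : 0 < l) (hρ : 0 < ρ) (hγ : 0 < γ) (hη : 0 < η)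
    (hL : 1 ≤ logFactor d l γ δ) : 0 < unitS d l ρ γ δ η := by
  have : 0 < logFactor d l γ δ := by linarith
  unfold unitS; positivity

theorem unitRadius_pos (hl : 0 < l) (hρ : 0 < ρ) (hγ : 0 < γ) (hη : 0 < η)
    (hL : 1 ≤ logFactor d l γ δ) : 0 < unitRadius d l ρ γ δ η := by
  have : 0 < logFactor d l γ δ := by linarith
  have := unitS_pos hl hρ hγ hη hL
  unfold unitRadius; positivity

theorem unitRadius_le_unitS (hl : 0 < l) (hρ : 0 < ρ) (hγ : 0 < γ) (hγl : γ ≤ l) (hη : 0 < η)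
    (hL : 1 ≤ logFactor d l γ δ) : unitRadius d l ρ γ δ η ≤ unitS d l ρ γ δ η := by
  refine div_le_self (unitS_pos hl hρ hγ hη hL).le ?_
  exact one_le_mul_of_one_le_of_one_le ((one_le_div hγ).2 hγl) hL

/-- The localization scale: a drop of order `ℱ` over a time of order `𝒯` confines the iterates to
distance of order `𝒮`. -/
theorem unitT_mul_unitF (hl : 0 < l) (hγ : 0 < γ) (hη : 0 < η)
    (hL : 1 ≤ logFactor d l γ δ) :
    unitT d l γ δ η * (η * unitF d l ρ γ δ η) = unitS d l ρ γ δ η ^ 2 := by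
  have hL0 : 0 < logFactor d l γ δ := by linarith
  unfold unitT unitF unitS
  rw [div_pow, mul_pow, Real.sq_sqrt (by positivity)]
  field_simp

/-- The linearization error accumulated over time `𝒯` at distance `𝒮`; a small `η * l` makes it
small. -/
theorem unitT_mul_unitS (hρ : 0 < ρ) (hγ : 0 < γ) (hη : 0 < η)
    (hL : 1 ≤ logFactor d l γ δ) :
    unitT d l γ δ η * (η * (ρ * unitS d l ρ γ δ η)) = √(η * l) := by
  have hL0 : 0 < logFactor d l γ δ := by linarith
  unfold unitT unitS
  field_simp

theorem unitF_pos (hl : 0 < l) (hρ : 0 < ρ) (hγ : 0 < γ) (hη : 0 < η)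
    (hL : 1 ≤ logFactor d l γ δ) : 0 < unitF d l ρ γ δ η := by
  have hL0 : 0 < logFactor d l γ δ := by linarith
  unfold unitF; positivity

theorem unitG_mul_unitRadius_le (hl : 0 < l) (hρ : 0 < ρ) (hγ : 0 < γ) (hγl : γ ≤ l)
    (hη : 0 < η) (hL : 1 ≤ logFactor d l γ δ) :
    unitG d l ρ γ δ η * unitRadius d l ρ γ δ η ≤ unitF d l ρ γ δ η := by
  have hL0 : 0 < logFactor d l γ δ := by linarith
  have h1 : 1 ≤ l / γ * logFactor d l γ δ :=
    one_le_mul_of_one_le_of_one_le ((one_le_div hγ).2 hγl) hL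
  refine le_trans (le_of_eq ?_) (div_le_self (unitF_pos hl hρ hγ hη hL).le h1)
  unfold unitG unitRadius unitF unitS
  have h2 : √(η * l) ^ 2 = η * l := Real.sq_sqrt (by positivity)
  field_simp
  rw [h2]

theorem mul_unitRadius_sq_le (hl : 0 < l) (hρ : 0 < ρ) (hγ : 0 < γ) (hγl : γ ≤ l)
    (hη : 0 < η) (hL : 1 ≤ logFactor d l γ δ) :
    l * unitRadius d l ρ γ δ η ^ 2 ≤ unitF d l ρ γ δ η := by
  refine le_trans (le_of_eq ?_) (unitG_mul_unitRadius_le hl hρ hγ hγl hη hL)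
  have hL0 : 0 < logFactor d l γ δ := by linarith
  unfold unitG unitRadius unitS
  field_simp

theorem one_le_unitT (hγ : 0 < γ) (hη : 0 < η) (hηγ : η * γ ≤ 1)
    (hL : 1 ≤ logFactor d l γ δ) : 1 ≤ unitT d l γ δ η :=
  (one_le_div (by positivity)).2 (hηγ.trans hL)

end Units

/-! ### Thinness of the stuck region and escape probability -/

variable {d : ℕ} {f : EuclideanSpace ℝ (Fin d) → ℝ} {l ρ γ δ η : ℝ}
  {x' : EuclideanSpace ℝ (Fin d)}

theorem IsSmooth.le_of_lambdaMin_le (hf : IsSmooth l f) (hl : 0 < l) (hγ : 0 < γ)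
    (hmin : lambdaMin (hessian f x') ≤ -γ) : γ ≤ l := by
  obtain ⟨e, he1, he⟩ := exists_eigenvector_lambdaMin (A := hessian f x') (by linarith)
  have h := (hessian f x').le_of_opNorm_le (hf.norm_hessian_le hl.le x') e
  rw [he, norm_smul, he1, mul_one, mul_one, Real.norm_eq_abs] at h
  linarith [neg_le_abs (lambdaMin (hessian f x'))]

/-- The stuck region is thin in the minimum eigendirections. -/
theorem stuckRegion_width (hl : 0 < l) (hρ : 0 < ρ) (hγ : 0 < γ) (hδ : 0 < δ)
    (hδd : δ ≤ d * (l / γ) / Real.exp 1) (hη : 0 < η) (hηl : η * l ≤ 1 / 4000000)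
    (hf : IsSmooth l f) (hf' : IsHessianLipschitz ρ f)
    (hmin : lambdaMin (hessian f x') ≤ -γ) {T : ℕ} (hT : 32 * unitT d l γ δ η ≤ T) {D : ℝ}
    (hD : D ≤ 3 * unitF d l ρ γ δ η) {e u : EuclideanSpace ℝ (Fin d)} (he1 : ‖e‖ = 1)
    (he : hessian f x' e = lambdaMin (hessian f x') • e) {s : ℝ}
    (hu : u ∈ stuckRegion f η x' (unitRadius d l ρ γ δ η) D T)
    (hw : u + s • e ∈ stuckRegion f η x' (unitRadius d l ρ γ δ η) D T) :
    |s| < δ * unitRadius d l ρ γ δ η / (2 * √d) := by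
  obtain ⟨hL, hexp⟩ := one_le_logFactor hδ hδd
  have hγl := hf.le_of_lambdaMin_le hl hγ hmin
  have hηγ : η * γ ≤ 1 := by nlinarith
  have hηl2 : η * l ≤ 1 / 2 := by linarith
  have hT1 := one_le_unitT hγ hη hηγ hL
  set L := logFactor d l γ δ with hLdef
  set τ := unitT d l γ δ η with hτ
  set S := unitS d l ρ γ δ η with hSdef
  set r := unitRadius d l ρ γ δ η with hrdef
  set F := unitF d l ρ γ δ η with hF
  have hSpos : 0 < S := unitS_pos hl hρ hγ hη hL
  have hrpos : 0 < r := unitRadius_pos hl hρ hγ hη hL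
  have hrS : r ≤ S := unitRadius_le_unitS hl hρ hγ hγl hη hL
  have hFpos : 0 < F := unitF_pos hl hρ hγ hη hL
  have hσ : √(η * l) ≤ 1 / 2000 := Real.sqrt_le_iff.2 ⟨by norm_num, hηl.trans (by norm_num)⟩
  -- A fixed horizon replaces the arbitrary `T`, over which the linearization errors could
  -- accumulate without bound. The factor `16` gives growth `exp (8 * L)`, and rounding up stays
  -- below `32 * τ` since `τ ≥ 1`.
  set N := ⌈16 * τ⌉₊ with hN
  have hN1 : 16 * τ ≤ N := Nat.le_ceil _
  have hN2 : (N : ℝ) ≤ 32 * τ := by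
    have := Nat.ceil_lt_add_one (show 0 ≤ 16 * τ by linarith)
    linarith
  have hNT : N ≤ T := by exact_mod_cast hN2.trans hT
  have hmono : stuckRegion f η x' r D T ⊆ stuckRegion f η x' r (3 * F) N := by
    intro z hz
    refine ⟨hz.1, ?_⟩
    have h1 : f (gdIter f η z T) ≤ f (gdIter f η z N) :=
      hf.gdIter_antitone hl.le hη.le hηl2 z hNT
    have h2 := hz.2
    linarith
  -- The radius `15 * S` works because `32 * 2 * 3 = 192 ≤ 14 ^ 2`, with one further `S` covering
  -- `r`. The error sum is `960 * √(η * l) ≤ 960 / 2000`.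
  have key := abs_mul_pow_le_of_stuck hf hf' hl.le hρ.le hη.le hηl2 (r := r) (R := 15 * S)
    (D := 3 * F) (T := N) (s := s) (by linarith) (by linarith)
    (by
      have h1 : τ * (η * F) = S ^ 2 := unitT_mul_unitF hl hγ hη hL
      calc (N : ℝ) * (2 * η * (3 * F)) ≤ 32 * τ * (2 * η * (3 * F)) := by gcongr
        _ = 192 * S ^ 2 := by rw [← h1]; ring
        _ ≤ (14 * S) ^ 2 := by nlinarith
        _ ≤ (15 * S - r) ^ 2 := by gcongr; linarith)
    (by
      have h1 : τ * (η * (ρ * S)) = √(η * l) := unitT_mul_unitS hρ hγ hη hL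
      calc 2 * (N : ℝ) * (η * (ρ * (15 * S))) ≤ 2 * (32 * τ) * (η * (ρ * (15 * S))) := by gcongr
        _ = 960 * √(η * l) := by rw [← h1]; ring
        _ ≤ 1 / 2 := by linarith)
    (by linarith) he1 he (hmono hu) (hmono hw)
  by_contra! hs
  have hpow : Real.exp (8 * L) ≤ (1 - η * lambdaMin (hessian f x')) ^ N := by
    have h1 : Real.exp (η * γ / 2) ≤ 1 - η * lambdaMin (hessian f x') :=
      (exp_half_le_one_add (by positivity) hηγ).trans (by nlinarith)
    have h2 : 8 * L ≤ N * (η * γ / 2) := by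
      have h3 : τ * (η * γ) = L := by
        rw [hτ, unitT, div_mul_cancel₀ _ (by positivity)]
      nlinarith [mul_pos hη hγ]
    calc _ ≤ Real.exp (N * (η * γ / 2)) := Real.exp_le_exp.2 h2
      _ = Real.exp (η * γ / 2) ^ N := Real.exp_nat_mul _ _
      _ ≤ _ := by gcongr
  have hL0 : 0 < L := by linarith
  have hd : 0 < d := by
    rcases Nat.eq_zero_or_pos d with h | h
    · subst h
      simp at hδd
      linarith
    · exact h
  have hd1 : (1 : ℝ) ≤ d := by exact_mod_cast hd
  have hsqrt : √(d : ℝ) ≤ d := Real.sqrt_le_iff.2 ⟨by linarith, by nlinarith⟩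
  have hsd : 0 < √(d : ℝ) := Real.sqrt_pos.2 (by linarith)
  -- One factor `exp L = d κ / δ` cancels `δ`, `κ` and the dimension in the claimed width. The
  -- remaining `exp (7 * L)` must beat `60 * S = 4 * R` divided by `S / (2 * L)`, that is `120 * L`.
  have hlow : S / (2 * L) ≤ Real.exp L * (δ * r / (2 * √d)) := by
    rw [hexp]
    have : d * (l / γ) / δ * (δ * r / (2 * √d)) = S / (2 * L) * (d / √d) := by
      rw [hrdef, unitRadius, ← hSdef, ← hLdef]
      field_simp
    rw [this]
    exact le_mul_of_one_le_right (by positivity) ((one_le_div hsd).2 hsqrt)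
  have h7 := mul_lt_exp_seven hL
  have h8 : Real.exp (7 * L) * (S / (2 * L)) ≤ 60 * S := by
    calc _ ≤ Real.exp (7 * L) * (Real.exp L * (δ * r / (2 * √d))) := by gcongr
      _ = Real.exp (8 * L) * (δ * r / (2 * √d)) := by
        rw [← mul_assoc, ← Real.exp_add]; congr 2; ring
      _ ≤ (1 - η * lambdaMin (hessian f x')) ^ N * |s| :=
        mul_le_mul hpow hs (by positivity) ((Real.exp_pos _).le.trans hpow)
      _ ≤ 60 * S := by linarith
  have h9 : 120 * L * (S / (2 * L)) < Real.exp (7 * L) * (S / (2 * L)) := by gcongr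
  have h10 : 120 * L * (S / (2 * L)) = 60 * S := by field_simp; norm_num
  linarith

/-- Perturbed gradient descent escapes a strict saddle point with high probability. -/
theorem le_uniformBall_escape (hl : 0 < l) (hρ : 0 < ρ) (hγ : 0 < γ) (hδ : 0 < δ)
    (hδd : δ ≤ d * (l / γ) / Real.exp 1) (hη : 0 < η) (hηl : η * l ≤ 1 / 4000000)
    (hf : IsSmooth l f) (hf' : IsHessianLipschitz ρ f)
    (hg : ‖gradient f x'‖ ≤ unitG d l ρ γ δ η)
    (hmin : lambdaMin (hessian f x') ≤ -γ) {N : ℕ} (hN : 32 * unitT d l γ δ η ≤ N) :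
    1 - δ ≤ (uniformBall d (unitRadius d l ρ γ δ η)).real
      {ξ | ∀ T : ℕ, N ≤ T → f (gdIter f η (x' + ξ) T) - f x' ≤ -unitF d l ρ γ δ η} := by
  obtain ⟨hL, -⟩ := one_le_logFactor hδ hδd
  have hγl := hf.le_of_lambdaMin_le hl hγ hmin
  have hηl2 : η * l ≤ 1 / 2 := by linarith
  obtain ⟨e, he1, he⟩ := exists_eigenvector_lambdaMin (A := hessian f x') (by linarith)
  rcases d with _ | n
  · simp [Subsingleton.elim e 0] at he1
  set r := unitRadius (n + 1) l ρ γ δ η with hr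
  set F := unitF (n + 1) l ρ γ δ η with hF
  have hrpos : 0 < r := unitRadius_pos hl hρ hγ hη hL
  -- The drop `3 * F` pays for two units lost to the perturbation, one through the gradient at `x'`
  -- and one through smoothness, and leaves a net decrease `F`. The single time `N` suffices, as
  -- later iterates only decrease `f`.
  refine le_uniformBall_of_width (S := {ξ | x' + ξ ∈ stuckRegion f η x' r (3 * F) N}) (e := e)
    hrpos hδ.le ?_ (fun ξ hξ => by simpa [stuckRegion] using hξ.1) he1 (fun ξ hξ s hs => ?_)
    (fun ξ hξ T hT => ?_)
  · have hc : Continuous fun ξ => x' + ξ := by fun_prop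
    have h1 : Continuous fun ξ => f (gdIter f η (x' + ξ) N) - f (x' + ξ) :=
      (hf.1.continuous.comp ((hf.continuous_gdIter η N).comp hc)).sub (hf.1.continuous.comp hc)
    have h2 : MeasurableSet ((fun ξ => x' + ξ) ⁻¹' closedBall x' r) :=
      (isClosed_closedBall.preimage hc).measurableSet
    have h3 : MeasurableSet
        ((fun ξ => f (gdIter f η (x' + ξ) N) - f (x' + ξ)) ⁻¹' Set.Ioi (-(3 * F))) :=
      (isOpen_Ioi.preimage h1).measurableSet
    exact h2.inter h3
  · rw [Set.mem_ofPred_eq, ← add_assoc] at hs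
    exact (stuckRegion_width hl hρ hγ hδ hδd hη hηl hf hf' hmin hN le_rfl he1 he hξ hs).le
  · have hξr : ‖ξ‖ ≤ r := mem_closedBall_zero_iff.1 hξ.1
    have hdrop : f (gdIter f η (x' + ξ) N) - f (x' + ξ) ≤ -(3 * F) := by
      by_contra! h
      exact hξ.2 ⟨by simpa using hξr, h⟩
    have hanti : f (gdIter f η (x' + ξ) T) ≤ f (gdIter f η (x' + ξ) N) :=
      hf.gdIter_antitone hl.le hη.le hηl2 _ hT
    have hstart := hf.le_linear_add hl.le x' (x' + ξ)
    rw [add_sub_cancel_left] at hstart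
    have h1 : inner ℝ (gradient f x') ξ ≤ F :=
      calc _ ≤ ‖gradient f x'‖ * ‖ξ‖ := real_inner_le_norm _ _
        _ ≤ unitG (n + 1) l ρ γ δ η * r := by
          gcongr
          exact (norm_nonneg _).trans hg
        _ ≤ F := unitG_mul_unitRadius_le hl hρ hγ hγl hη hL
    have h2 : l * ‖ξ‖ ^ 2 ≤ F :=
      calc _ ≤ l * r ^ 2 := by gcongr
        _ ≤ F := mul_unitRadius_sq_le hl hρ hγ hγl hη hL
    linarith

theorem le_uniformBall_escape_of_thresholds {d : ℕ} {f : EuclideanSpace ℝ (Fin d) → ℝ}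
    {l ρ ε c χ : ℝ} {x' : EuclideanSpace ℝ (Fin d)} (hl : 0 < l) (hρ : 0 < ρ) (hε : 0 < ε)
    (hc : 0 < c) (hc1 : c ≤ 1 / 4000000) (hχ : 1 ≤ χ) (hf : IsSmooth l f)
    (hf' : IsHessianLipschitz ρ f) (hg : ‖gradient f x'‖ ≤ gThres ε c χ)
    (hmin : lambdaMin (hessian f x') ≤ -√(ρ * ε)) :
    1 - d * l / √(ρ * ε) * Real.exp (-χ) ≤
      (uniformBall d (radius l ε c χ)).real
        {ξ | ∀ T : ℕ, ⌊tThres l ρ ε c χ⌋₊ ≤ T →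
          f (gdIter f (stepSize l c) (x' + ξ) T) - f x' ≤ -fThres ρ ε c χ} := by
  set γ := √(ρ * ε) with hγdef
  have hγ : 0 < γ := Real.sqrt_pos.2 (by positivity)
  have hγ2 : γ ^ 2 = ρ * ε := Real.sq_sqrt (by positivity)
  have hγl := hf.le_of_lambdaMin_le hl hγ hmin
  obtain ⟨e, he1, -⟩ := exists_eigenvector_lambdaMin (A := hessian f x') (by linarith)
  have hd : (0 : ℝ) < d := by
    rcases Nat.eq_zero_or_pos d with h | h
    · subst h
      simp [Subsingleton.elim e 0] at he1
    · exact_mod_cast h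
  -- This choice makes `d κ / δ = exp χ`; the condition `δ ≤ d κ / e` becomes `1 ≤ χ`.
  set δ := d * l / γ * Real.exp (-χ) with hδdef
  have hδ : 0 < δ := by positivity
  have hδd : δ ≤ d * (l / γ) / Real.exp 1 := by
    rw [hδdef, div_eq_mul_inv _ (Real.exp 1), ← Real.exp_neg, mul_div_assoc]
    gcongr
  have hlog : logFactor d l γ δ = χ := by
    have : d * (l / γ) / δ = Real.exp χ := by
      rw [hδdef, Real.exp_neg]
      field_simp
    rw [logFactor, this, Real.log_exp]
  have hηl : c / l * l = c := div_mul_cancel₀ _ hl.ne'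
  have hεeq : ε = γ ^ 2 / ρ := by rw [hγ2]; field_simp
  have hG : unitG d l ρ γ δ (stepSize l c) = gThres ε c χ := by
    rw [unitG, hlog, stepSize, hηl, gThres, hεeq]
    ring
  have hR : unitRadius d l ρ γ δ (stepSize l c) = radius l ε c χ := by
    rw [unitRadius, unitS, hlog, stepSize, hηl, radius, hεeq]
    field_simp
  have hF : unitF d l ρ γ δ (stepSize l c) = fThres ρ ε c χ := by
    have : √(ε ^ 3 / ρ) = γ ^ 3 / ρ ^ 2 := by
      rw [hεeq]
      have : (γ ^ 2 / ρ) ^ 3 / ρ = (γ ^ 3 / ρ ^ 2) ^ 2 := by field_simp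
      rw [this, Real.sqrt_sq (by positivity)]
    rw [unitF, hlog, stepSize, hηl, fThres, this]
    ring
  have hT : unitT d l γ δ (stepSize l c) = χ * l / (c * γ) := by
    rw [unitT, hlog, stepSize]
    field_simp
  rw [← hR, ← hF]
  refine le_uniformBall_escape hl hρ hγ hδ hδd (by unfold stepSize; positivity)
    (by rw [stepSize, hηl]; exact hc1) hf hf' (hG ▸ hg) hmin ?_
  have hT1 : 1 ≤ χ * l / (c * γ) := by
    rw [one_le_div (by positivity)]
    have hcχ : c ≤ χ := by linarith
    exact mul_le_mul hcχ hγl hγ.le (by linarith)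
  have hT2 : tThres l ρ ε c χ = χ * l / (c * γ) / c := by
    rw [tThres, ← hγdef]
    field_simp
  -- The threshold carries an extra factor `1 / c` over `𝒯`; as `𝒯 ≥ 1`, losing up to one step to
  -- the floor still leaves more than `32 * 𝒯`.
  have hT3 : 4000000 * (χ * l / (c * γ)) ≤ tThres l ρ ε c χ := by
    rw [hT2, le_div_iff₀ hc]
    nlinarith
  have hfl := Nat.lt_floor_add_one (tThres l ρ ε c χ)
  rw [hT]
  linarith

end SaddleEscape

end

/-! ### The two formulations with a common constant -/

theorem lemma7 :
    ∃ cmax : ℝ, 0 < cmax ∧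
      -- formulation with the parameters of the algorithm
      (∀ (d : ℕ) (f : EuclideanSpace ℝ (Fin d) → ℝ) (l ρ ε c χ : ℝ)
          (x' : EuclideanSpace ℝ (Fin d)),
        0 < l → 0 < ρ → 0 < ε → 0 < c → c ≤ cmax → 1 ≤ χ →
        SaddleEscape.IsSmooth l f → SaddleEscape.IsHessianLipschitz ρ f →
        ‖gradient f x'‖ ≤ SaddleEscape.gThres ε c χ →
        SaddleEscape.lambdaMin (SaddleEscape.hessian f x') ≤ -√(ρ * ε) →
        1 - d * l / √(ρ * ε) * Real.exp (-χ) ≤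
          (SaddleEscape.uniformBall d (SaddleEscape.radius l ε c χ)).real
            {ξ | ∀ T : ℕ, ⌊SaddleEscape.tThres l ρ ε c χ⌋₊ ≤ T →
              f (SaddleEscape.gdIter f (SaddleEscape.stepSize l c) (x' + ξ) T) - f x' ≤
                -SaddleEscape.fThres ρ ε c χ}) ∧
      -- formulation with a free failure probability, eigenvalue bound and step size
      (∀ (d : ℕ) (f : EuclideanSpace ℝ (Fin d) → ℝ) (l ρ γ δ η : ℝ)
          (x' : EuclideanSpace ℝ (Fin d)),
        0 < l → 0 < ρ → 0 < γ → 0 < δ → δ ≤ d * (l / γ) / Real.exp 1 →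
        0 < η → η ≤ cmax / l →
        SaddleEscape.IsSmooth l f → SaddleEscape.IsHessianLipschitz ρ f →
        ‖gradient f x'‖ ≤ SaddleEscape.unitG d l ρ γ δ η →
        SaddleEscape.lambdaMin (SaddleEscape.hessian f x') ≤ -γ →
        1 - δ ≤
          (SaddleEscape.uniformBall d (SaddleEscape.unitRadius d l ρ γ δ η)).real
            {ξ | ∀ T : ℕ, 1 / cmax * SaddleEscape.unitT d l γ δ η ≤ T →
              f (SaddleEscape.gdIter f η (x' + ξ) T) - f x' ≤
                -SaddleEscape.unitF d l ρ γ δ η} ∧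
        -- width of the stuck region along every minimum eigendirection
        ∀ T : ℕ, 1 / cmax * SaddleEscape.unitT d l γ δ η ≤ T →
          ∀ e : EuclideanSpace ℝ (Fin d), ‖e‖ = 1 →
            SaddleEscape.hessian f x' e =
              SaddleEscape.lambdaMin (SaddleEscape.hessian f x') • e →
            ∀ u ∈ SaddleEscape.stuckRegion f η x' (SaddleEscape.unitRadius d l ρ γ δ η)
                (5 / 2 * SaddleEscape.unitF d l ρ γ δ η) T,
              ∀ s : ℝ,
                u + s • e ∈
                  SaddleEscape.stuckRegion f η x' (SaddleEscape.unitRadius d l ρ γ δ η)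
                    (5 / 2 * SaddleEscape.unitF d l ρ γ δ η) T →
                |s| < δ * SaddleEscape.unitRadius d l ρ γ δ η / (2 * √d)) := by
  -- The constant is `(1 / 2000) ^ 2`, so that `√(η * l) ≤ 1 / 2000` in the linearization estimate;
  -- its inverse far exceeds the required time factor `32`.
  refine ⟨1 / 4000000, by norm_num, ?_, ?_⟩
  · intro d f l ρ ε c χ x' hl hρ hε hc hc1 hχ hf hf' hg hmin
    exact SaddleEscape.le_uniformBall_escape_of_thresholds hl hρ hε hc hc1 hχ hf hf' hg hmin
  · intro d f l ρ γ δ η x' hl hρ hγ hδ hδd hη hηl hf hf' hg hmin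
    have hηl' : η * l ≤ 1 / 4000000 := (le_div_iff₀ hl).1 hηl
    have hL := (SaddleEscape.one_le_logFactor hδ hδd).1
    have hγl := hf.le_of_lambdaMin_le hl hγ hmin
    have hT0 := SaddleEscape.one_le_unitT hγ hη (by nlinarith) hL
    have hTime : ∀ T : ℕ, 1 / (1 / 4000000) * SaddleEscape.unitT d l γ δ η ≤ T →
        32 * SaddleEscape.unitT d l γ δ η ≤ T := fun T hT => by
      norm_num at hT
      linarith
    refine ⟨?_, ?_⟩
    · simp only [← Nat.ceil_le]
      exact SaddleEscape.le_uniformBall_escape hl hρ hγ hδ hδd hη hηl' hf hf' hg hmin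
        (hTime _ (Nat.le_ceil _))
    · intro T hT e he1 he u hu s hw
      have hF := SaddleEscape.unitF_pos hl hρ hγ hη hL
      exact SaddleEscape.stuckRegion_width hl hρ hγ hδ hδd hη hηl' hf hf' hmin (hTime T hT)
        (by linarith) he1 he hu hw
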